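/- Let $n\ge 1$ and let the rows and columns of $n\times n$ matrices be indexed by $\mathbb{Z}/n\mathbb{Z}$, in its natural circular order. For integers $a,b$ and $y\ge 0$ let $\mathrm{CM}_{a,b,y}(M)=\det M_{a,a+1,\dots,a+y-1}^{b+y-1,\dots,b+1,b}$ be the minor of $M$ with rows $a,\dots,a+y-1$ and columns $b+y-1,\dots,b$, in these orders, with indices taken modulo $n$. The central minor $\mathrm{CM}_{x,y}(M)$ is $\mathrm{CM}_{a,b,y}(M)$ with $a=\left\lfloor\frac{x-y}{2}\right\rfloor$ and $b=\left\lfloor\frac{x-y+n-((n-1)\bmod 2)}{2}\right\rfloor$. The small central minors of $M$ are the $\mathrm{CM}_{x,y}(M)$ with $1\le x\le 2n$ and with either $1\le y<n/2$, or $y=n/2$ and $x+y$ odd. Let $A,B\subseteq\mathbb{Z}/n\mathbb{Z}$ be noninterlaced sets of the same size, that is, $A$ and $B$ are contained in disjoint circular intervals, and let $\det M_A^B$ be the minor of $M$ with the rows $A$ listed in increasing order along their interval and the columns $B$ listed in decreasing order along theirs. Then $\det M_A^B$ is a positive (subtraction-free) rational function of the small central minors: there are nonzero polynomials $P,Q$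 with nonnegative integer coefficients, in variables $v_{x,y}$ indexed by the small central minors and depending only on $n,A,B$, such that $Q$, evaluated at the small central minors of the generic matrix $(X_{i,j})$ over $\mathbb{Z}[X_{i,j}]$, is not the zero polynomial, and such that for every $n\times n$ matrix $M$ over every commutative ring $$\det M_A^B\cdot Q\big((\mathrm{CM}_{x,y}(M))_{x,y}\big)=P\big((\mathrm{CM}_{x,y}(M))_{x,y}\big).$$ In particular, over a field, $\det M_A^B=P/Q$ wherever $Q\neq0$, for instance for every real $M$ all of whose small central minors are positive. -/

import Mathlib

/-- The circular interval `{s, s+1, …, s+l-1}` of the set `ZMod n` of the `n` circularly ordered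
indices (the index usually called `n` is the residue `0`). -/
def cyclicInterval {n : ℕ} (s : ZMod n) (l : ℕ) : Finset (ZMod n) :=
  (Finset.range l).image fun i : ℕ => s + (i : ZMod n)

/-- The distances from `s` to the elements of `A`, going round the circle in positive direction. -/
def cyclicOffsets {n : ℕ} (s : ZMod n) (A : Finset (ZMod n)) : Finset ℕ :=
  A.image fun x => (x - s).val

theorem card_cyclicOffsets {n : ℕ} [NeZero n] (s : ZMod n) (A : Finset (ZMod n)) :
    (cyclicOffsets s A).card = A.card := by
  refine Finset.card_image_of_injective A fun x y h => ?_
  exact sub_left_injective (ZMod.val_injective n h)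

/-- The elements of `A`, listed in the order in which they are met when one goes once round the
circle in positive direction, starting at `s`. -/
def cyclicEnum {n : ℕ} [NeZero n] (s : ZMod n) (A : Finset (ZMod n)) (i : Fin A.card) : ZMod n :=
  s + (((cyclicOffsets s A).orderEmbOfFin (card_cyclicOffsets s A) i : ℕ) : ZMod n)

/-- The minor of `M` with row set `A`, the rows being listed in increasing circular order from `s`,
and column set `B`, the columns being listed in decreasing circular order, that is, in the reverse
of their increasing order from `t`.  It is used when `A` and `B` lie in disjoint circular intervals
that start at `s` and at `t`. -/
def cyclicMinor {n : ℕ} [NeZero n] {R : Type*} [CommRing R] (M : Matrix (ZMod n) (ZMod n) R)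
    (s t : ZMod n) (A B : Finset (ZMod n)) (h : A.card = B.card) : R :=
  Matrix.det (Matrix.of fun i j : Fin A.card =>
    M (cyclicEnum s A i) (cyclicEnum t B (Fin.cast h (Fin.rev j))))

/-- The contiguous minor with rows `a, a+1, …, a+y-1` and columns `b+y-1, …, b+1, b`
(in these orders), all indices being taken modulo `n`. -/
def contiguousMinor {n : ℕ} {R : Type*} [CommRing R] (M : Matrix (ZMod n) (ZMod n) R)
    (a b : ℤ) (y : ℕ) : R :=
  Matrix.det (Matrix.of fun i j : Fin y =>
    M ((a + (i : ℤ) : ℤ) : ZMod n) ((b + (y : ℤ) - 1 - (j : ℤ) : ℤ) : ZMod n))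

/-- The central minor `CM_{x,y}`: the contiguous minor with
`a = ⌊(x-y)/2⌋` and `b = ⌊(x-y+n-((n-1) mod 2))/2⌋` (division by `2` in `ℤ` rounds down). -/
def centralMinor {n : ℕ} {R : Type*} [CommRing R] (M : Matrix (ZMod n) (ZMod n) R)
    (x y : ℕ) : R :=
  contiguousMinor M (((x : ℤ) - y) / 2) (((x : ℤ) - y + n - ((n : ℤ) - 1) % 2) / 2) y

/-- The index set of the small central minors of an `n × n` matrix: `1 ≤ x ≤ 2n`, and `1 ≤ y < n/2`
or `y = n/2` and `x + y` is odd. -/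
def SmallIndex (n : ℕ) : Type :=
  {p : ℕ × ℕ // (1 ≤ p.1 ∧ p.1 ≤ 2 * n) ∧ 1 ≤ p.2 ∧ (2 * p.2 < n ∨ (2 * p.2 = n ∧ Odd (p.1 + p.2)))}

/-- The family of the small central minors of `M`. -/
def smallCentralMinors {n : ℕ} {R : Type*} [CommRing R] (M : Matrix (ZMod n) (ZMod n) R)
    (p : SmallIndex n) : R :=
  centralMinor M p.1.1 p.1.2

/-!
All minors are taken of the generic matrix, over the fraction field of `ℤ[X_{i,j}]`, where a minor
with distinct rows and distinct columns is not zero.  The elements of this field that are quotients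
of polynomials with nonnegative integer coefficients in the small central minors form a semiring
closed under inverses, `subtractionFree`.  A minor in this semiring satisfies an identity
`minor * Q = P` in `ℤ[X_{i,j}]`, which specializes to all matrices over all commutative rings.
It remains to see that every noninterlaced minor belongs to the semiring, and this takes two steps.

* Contiguous minors (`contiguousMinor_mem`).  Let `d` be the distance from the first row to the
  lowest column of a contiguous minor.  As the columns are listed in decreasing order, Dodgson
  condensation has only positive signs: the minors of distances `d - 1` and `d + 1` have products
  that are sums of products of minors of distance `d`.  The small central minors are the
  noninterlaced minors of two consecutive distances next to `n / 2`, so the recurrence can be run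
  from them in both directions, and the minors that it uses stay noninterlaced.
* Arbitrary minors (`det_submatrix_mem_of_interval_minors`).  Disjoint circular intervals of rows
  and columns cut out a rectangular block whose interval minors are noninterlaced contiguous
  minors.  If the row set of a minor has a gap, then a three-term Plücker relation with a row from
  the gap expresses the minor by smaller minors and by minors of smaller row span, again without
  subtraction; columns are treated likewise.

Both recurrences come from one exchange relation, `det_exchange`; condensation is the case in which
one of the rows is a unit vector.
-/

/-! ### Determinantal identities -/

/-- Deleting row `i` of an `(n+1) × n` matrix gives maximal minors that are, with alternating
signs, the coefficients of a linear dependence of the rows. -/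
theorem sum_alternating_maximal_minor_mul_eq_zero {R : Type*} [CommRing R] {n : ℕ}
    (W : Matrix (Fin (n + 1)) (Fin n) R) (j : Fin n) :
    ∑ i : Fin (n + 1), (-1) ^ (i : ℕ) * W i j * (W.submatrix i.succAbove id).det = 0 := by
  have h := Matrix.det_succ_column_zero
    (Matrix.of fun i : Fin (n + 1) => Fin.cons (W i j) (W i) : Matrix _ (Fin (n + 1)) R)
  rw [Matrix.det_zero_of_column_eq (i := 0) (j := j.succ) (Fin.succ_ne_zero j).symm
    (by intro i; simp)] at h
  exact h.symm

/-- The three-term exchange relation between the minors of an `(n+3) × (n+2)` matrix with all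
columns and the minors in which the last column is dropped.  The rows exchanged are the first, the
last, and an arbitrary row in between. -/
theorem det_exchange {R : Type*} [CommRing R] {n : ℕ}
    (W : Matrix (Fin (n + 3)) (Fin (n + 2)) R) (s : Fin (n + 1)) :
    (W.submatrix s.succ.castSucc.succAbove id).det
        * (W.submatrix (fun i : Fin (n + 1) => i.succ.castSucc) Fin.castSucc).det =
      (W.submatrix Fin.succ id).det
        * (W.submatrix (fun i => (s.succ.succAbove i).castSucc) Fin.castSucc).det
      + (W.submatrix Fin.castSucc id).det
        * (W.submatrix (fun i => (s.castSucc.succAbove i).succ) Fin.castSucc).det := by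
  -- the rows common to all the minors, and the cofactors of a further row
  set ω : Fin n → Fin (n + 3) := fun i => (s.succAbove i).succ.castSucc with hω
  set c : Fin (n + 1) → R := fun j =>
    (-1) ^ (j : ℕ) * (W.submatrix ω fun i => (j.succAbove i).castSucc).det with hc
  -- the determinant, up to sign, with row `i` adjoined to the common rows
  set ψ : Fin (n + 3) → R := fun i => ∑ j : Fin (n + 1), W i j.castSucc * c j with hψ
  have hmid : (W.submatrix (fun i : Fin (n + 1) => i.succ.castSucc) Fin.castSucc).det =
      (-1) ^ (s : ℕ) * ψ s.succ.castSucc := by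
    rw [Matrix.det_succ_row _ s, hψ, Finset.mul_sum]
    refine Finset.sum_congr rfl fun j _ => ?_
    simp only [hc, Matrix.submatrix_apply, Matrix.submatrix_submatrix, pow_add]
    simp only [Function.comp_def, hω]
    ring
  have hfst : (W.submatrix (fun i => (s.succ.succAbove i).castSucc) Fin.castSucc).det = ψ 0 := by
    rw [Matrix.det_succ_row_zero, hψ]
    refine Finset.sum_congr rfl fun j _ => ?_
    simp only [hc, Matrix.submatrix_apply, Matrix.submatrix_submatrix]
    simp only [Function.comp_def, hω, Fin.succ_succAbove_succ, Fin.succ_succAbove_zero,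
      Fin.castSucc_zero]
    ring
  have hlst : (W.submatrix (fun i => (s.castSucc.succAbove i).succ) Fin.castSucc).det =
      (-1) ^ n * ψ (Fin.last _) := by
    have hl : s.castSucc.succAbove (Fin.last n) = Fin.last (n + 1) := by
      rw [Fin.succAbove_castSucc_of_le _ _ (Fin.le_last s), Fin.succ_last]
    rw [Matrix.det_succ_row _ (Fin.last n), hψ, Finset.mul_sum]
    refine Finset.sum_congr rfl fun j _ => ?_
    simp only [hc, Matrix.submatrix_apply, Matrix.submatrix_submatrix, pow_add]
    simp only [Function.comp_def, hω, Fin.succAbove_last, Fin.castSucc_succAbove_castSucc,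
      hl, Fin.succ_last, Fin.val_last, Fin.succ_castSucc]
    ring
  have hzero : ∀ i, ψ (ω i) = 0 := by
    intro i
    have h := Matrix.det_succ_row_zero (Matrix.of fun (a b : Fin (n + 1)) =>
      W ((Fin.cons (ω i) ω : Fin (n + 1) → Fin (n + 3)) a) b.castSucc)
    rw [Matrix.det_zero_of_row_eq (i := 0) (j := i.succ) (Fin.succ_ne_zero i).symm
      (by ext; simp)] at h
    rw [h, hψ]
    refine Finset.sum_congr rfl fun j _ => ?_
    simp only [hc, Matrix.of_apply, Fin.cons_zero]
    rw [mul_left_comm, ← mul_assoc]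
    rfl
  -- apply `ψ` to the linear dependence of the rows; only the three exchanged rows contribute
  have hsum : ∑ i : Fin (n + 3),
      (-1) ^ (i : ℕ) * (W.submatrix i.succAbove id).det * ψ i = 0 := by
    simp only [hψ, Finset.mul_sum]
    rw [Finset.sum_comm]
    refine Finset.sum_eq_zero fun j _ => ?_
    have h := congrArg (· * c j) (sum_alternating_maximal_minor_mul_eq_zero W j.castSucc)
    simp only [Finset.sum_mul, zero_mul] at h
    rw [← h]
    exact Finset.sum_congr rfl fun i _ => by ring
  rw [Fin.sum_univ_castSucc, Fin.sum_univ_succ, Fin.sum_univ_succAbove _ s] at hsum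
  have hrest : ∑ i : Fin n, (-1) ^ (((s.succAbove i).succ.castSucc : Fin (n + 3)) : ℕ)
      * (W.submatrix (s.succAbove i).succ.castSucc.succAbove id).det
      * ψ (s.succAbove i).succ.castSucc = 0 :=
    Finset.sum_eq_zero fun i _ => by
      rw [show ψ (s.succAbove i).succ.castSucc = 0 from hzero i, mul_zero]
  rw [hrest] at hsum
  simp only [Fin.castSucc_zero, Fin.val_zero, pow_zero, one_mul, Fin.val_castSucc, Fin.val_succ,
    Fin.val_last, Fin.succAbove_last, Fin.succAbove_zero, add_zero] at hsum
  rw [hmid, hfst, hlst]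
  have e1 : (-1 : R) ^ (n + 2) = (-1) ^ n := by ring
  have e2 : (-1 : R) ^ ((s : ℕ) + 1) = - (-1) ^ (s : ℕ) := by ring
  rw [e1, e2] at hsum
  linear_combination -hsum

/-- The Desnanot–Jacobi identity (Dodgson condensation) for the four corners of a matrix. -/
theorem det_condensation {R : Type*} [CommRing R] {n : ℕ}
    (N : Matrix (Fin (n + 2)) (Fin (n + 2)) R) :
    (N.submatrix Fin.castSucc Fin.succ).det * (N.submatrix Fin.succ Fin.castSucc).det
        + N.det * (N.submatrix (fun i : Fin n => i.castSucc.succ) fun i => i.castSucc.succ).det =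
      (N.submatrix Fin.succ Fin.succ).det * (N.submatrix Fin.castSucc Fin.castSucc).det := by
  -- adjoin the first unit vector as a last row
  set W : Matrix (Fin (n + 3)) (Fin (n + 2)) R :=
    Matrix.of (Fin.snoc N (Pi.single 0 1) : Fin (n + 3) → Fin (n + 2) → R) with hW
  have hcast : ∀ i : Fin (n + 2), W i.castSucc = N i := fun i =>
    Fin.snoc_castSucc (α := fun _ => Fin (n + 2) → R) _ _ _
  have hlast : W (Fin.last _) = Pi.single 0 1 :=
    Fin.snoc_last (α := fun _ => Fin (n + 2) → R) _ _
  -- a determinant whose last row is the first unit vector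
  have hunit : ∀ {k : ℕ} (V : Matrix (Fin (k + 1)) (Fin (k + 1)) R),
      V (Fin.last k) = Pi.single 0 1 →
        V.det = (-1) ^ k * (V.submatrix Fin.castSucc Fin.succ).det := by
    intro k V hV
    rw [Matrix.det_succ_row V (Fin.last k), Fin.sum_univ_succ, Finset.sum_eq_zero]
    · simp [hV, Fin.succAbove_last]
    · intro j _
      simp [hV]
  have h := det_exchange W (Fin.last n)
  have e1 : (W.submatrix (Fin.last n).succ.castSucc.succAbove id).det =
      (-1) ^ (n + 1) * (N.submatrix Fin.castSucc Fin.succ).det := by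
    rw [hunit]
    · congr 2
      ext i j
      simp [← hcast, Fin.castSucc_succAbove_castSucc]
    · ext j
      simp [← hlast]
  have e2 : (W.submatrix (fun i : Fin (n + 1) => i.succ.castSucc) Fin.castSucc).det =
      (N.submatrix Fin.succ Fin.castSucc).det := by
    congr 1; ext i j; exact congrFun (hcast i.succ) j.castSucc
  have e3 : (W.submatrix Fin.succ id).det =
      (-1) ^ (n + 1) * (N.submatrix Fin.succ Fin.succ).det := by
    rw [hunit]
    · congr 2
      ext i j
      simp [← hcast]
    · ext j
      simp [← hlast]
  have e4 : (W.submatrix (fun i => ((Fin.last n).succ.succAbove i).castSucc) Fin.castSucc).det =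
      (N.submatrix Fin.castSucc Fin.castSucc).det := by
    congr 1; ext i j; simp [hcast]
  have e5 : (W.submatrix Fin.castSucc id).det = N.det := by
    congr 1; ext i j; simp [hcast]
  have e6 : (W.submatrix (fun i => ((Fin.last n).castSucc.succAbove i).succ) Fin.castSucc).det =
      (-1) ^ n * (N.submatrix (fun i : Fin n => i.castSucc.succ) fun i => i.castSucc.succ).det := by
    rw [hunit]
    · congr 2
      ext i j
      simp [← hcast, Fin.castSucc_succAbove_castSucc]
    · ext j
      have hl : (Fin.last n).castSucc.succAbove (Fin.last n) = Fin.last (n + 1) := by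
        rw [Fin.succAbove_castSucc_of_le _ _ le_rfl, Fin.succ_last]
      simp [hlast, hl, Pi.single_apply]
  rw [e1, e2, e3, e4, e5, e6] at h
  have hs : (-1 : R) ^ n * (-1) ^ n = 1 := by rw [← mul_pow]; simp
  have e7 : (-1 : R) ^ (n + 1) = -(-1) ^ n := by ring
  rw [e7] at h
  linear_combination (-(-1) ^ n) * h
    - ((N.submatrix Fin.castSucc Fin.succ).det * (N.submatrix Fin.succ Fin.castSucc).det
      + N.det * (N.submatrix (fun i : Fin n => i.castSucc.succ) fun i => i.castSucc.succ).det
      - (N.submatrix Fin.succ Fin.succ).det * (N.submatrix Fin.castSucc Fin.castSucc).det) * hs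

/-! ### Minors of a block from its interval minors -/

/-- A strictly increasing sequence of naturals is an interval or skips a number. -/
theorem StrictMono.eq_add_or_exists_gap {n : ℕ} {p : Fin (n + 1) → ℕ} (hp : StrictMono p) :
    (∀ i, p i = p 0 + i) ∨ ∃ i : Fin n, p i.castSucc + 1 < p i.succ := by
  by_contra! h
  obtain ⟨⟨i, hi⟩, hgap⟩ := h
  refine hi (Fin.induction (motive := fun i => p i = p 0 + i) (by simp) (fun j ih => ?_) i)
  have h1 := hp (Fin.castSucc_lt_succ (i := j))
  have h2 := hgap j
  simp only [Fin.val_castSucc, Fin.val_succ] at *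
  omega

/-- If all minors with rows in an interval lie in a semiring closed under inverses, then so do the
minors with arbitrary rows.  The column sets range over a family `C` closed under removal of the
last column.  A gap in the rows is filled by `det_exchange`, which expresses the minor through
minors of smaller size or smaller row span. -/
theorem det_submatrix_mem_of_interval_rows {K : Type*} [Field K] (S : Subsemiring K)
    (hinv : ∀ x ∈ S, x⁻¹ ∈ S) (N : Matrix ℕ ℕ K) (L : ℕ) (C : ∀ k, Set (Fin k → ℕ))
    (hC : ∀ k, ∀ q ∈ C (k + 1), (fun i : Fin k => q i.castSucc) ∈ C k)
    (hne : ∀ k (p : Fin k → ℕ), ∀ q ∈ C k, StrictMono p → (∀ i, p i < L) →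
      (N.submatrix p q).det ≠ 0)
    (hint : ∀ k a, ∀ q ∈ C k, a + k ≤ L →
      (N.submatrix (fun i : Fin k => a + (i : ℕ)) q).det ∈ S)
    (k : ℕ) (p q : Fin k → ℕ) (hp : StrictMono p) (hpL : ∀ i, p i < L) (hq : q ∈ C k) :
    (N.submatrix p q).det ∈ S := by
  induction k with
  | zero => simp [Matrix.det_isEmpty]
  | succ k ih =>
    induction hspan : p (Fin.last k) - p 0 using Nat.strong_induction_on generalizing p with
    | _ d ihd =>
    rcases hp.eq_add_or_exists_gap with h | ⟨i, hi⟩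
    · rw [funext h]
      refine hint _ _ _ hq ?_
      have h1 := h (Fin.last k)
      have h2 := hpL (Fin.last k)
      simp only [Fin.val_last] at h1
      omega
    · obtain ⟨n, rfl⟩ : ∃ n, k = n + 1 := ⟨k - 1, by have := i.2; omega⟩
      -- the rows `p` together with a row in the gap
      set f : Fin (n + 3) → ℕ :=
        Fin.insertNth (α := fun _ => ℕ) i.castSucc.succ (p i.castSucc + 1) p with hf
      have hfm : StrictMono f := Fin.strictMono_insertNth hp i _ (Nat.lt_succ_self _) hi
      have hfp : ∀ j, f (i.succ.castSucc.succAbove j) = p j := fun j =>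
        Fin.insertNth_apply_succAbove (α := fun _ => ℕ) i.castSucc.succ _ p j
      have hf0 : f 0 = p 0 := by
        rw [← hfp 0]
        congr 1
      have hfl : f (Fin.last _) = p (Fin.last _) := by
        rw [← hfp (Fin.last _), Fin.succAbove_castSucc_of_le _ _ (Fin.le_last _), Fin.succ_last]
      have hfL : ∀ j, f j < L := fun j =>
        (hfm.monotone (Fin.le_last j)).trans_lt (hfl ▸ hpL _)
      have hex := det_exchange (N.submatrix f q) i
      simp only [Matrix.submatrix_submatrix, Function.comp_def, hfp, id] at hex
      have hsmall : ∀ r : Fin (n + 1) → Fin (n + 3), StrictMono r →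
          (N.submatrix (fun j => f (r j)) fun j => q j.castSucc).det ∈ S := fun r hr =>
        ih _ _ (hfm.comp hr) (fun j => hfL _) (hC _ _ hq)
      have h0l : (N.submatrix (fun j : Fin (n + 1) => f j.succ.castSucc)
          fun j => q j.castSucc).det ≠ 0 :=
        hne _ _ _ (hC _ _ hq) (hfm.comp (Fin.strictMono_castSucc.comp Fin.strictMono_succ))
          fun j => hfL _
      rw [← eq_div_iff h0l, div_eq_mul_inv] at hex
      have h01 : f 0 < f 1 := hfm (by simp)
      have hll : f (Fin.last (n + 1)).castSucc < f (Fin.last _) :=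
        hfm (Fin.castSucc_lt_last _)
      have h1l : f 1 ≤ f (Fin.last _) := hfm.monotone (Fin.le_last _)
      have h0l' : f 0 ≤ f (Fin.last (n + 1)).castSucc := hfm.monotone (Fin.zero_le _)
      change (N.submatrix (fun j => p j) fun j => q j).det ∈ S
      rw [hex]
      refine S.mul_mem (S.add_mem (S.mul_mem ?_ ?_) (S.mul_mem ?_ ?_)) (hinv _ ?_)
      · refine ihd _ ?_ _ (hfm.comp Fin.strictMono_succ) (fun j => hfL _) rfl
        change f (Fin.last _) - f 1 < d
        omega
      · exact hsmall _ (Fin.strictMono_castSucc.comp (Fin.strictMono_succAbove _))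
      · refine ihd _ ?_ _ (hfm.comp Fin.strictMono_castSucc) (fun j => hfL _) rfl
        change f (Fin.last (n + 1)).castSucc - f 0 < d
        omega
      · exact hsmall _ (Fin.strictMono_succ.comp (Fin.strictMono_succAbove _))
      · exact hsmall _ (Fin.strictMono_castSucc.comp Fin.strictMono_succ)

/-- If the interval minors of an `L × L'` block lie in a semiring closed under inverses, and no
minor of the block vanishes, then all minors of the block lie in the semiring. -/
theorem det_submatrix_mem_of_interval_minors {K : Type*} [Field K] (S : Subsemiring K)
    (hinv : ∀ x ∈ S, x⁻¹ ∈ S) (N : Matrix ℕ ℕ K) (L L' : ℕ)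
    (hne : ∀ k (p q : Fin k → ℕ), StrictMono p → StrictMono q → (∀ i, p i < L) →
      (∀ i, q i < L') → (N.submatrix p q).det ≠ 0)
    (hint : ∀ k a b, a + k ≤ L → b + k ≤ L' →
      (N.submatrix (fun i : Fin k => a + (i : ℕ)) fun i : Fin k => b + (i : ℕ)).det ∈ S)
    (k : ℕ) (p q : Fin k → ℕ) (hp : StrictMono p) (hq : StrictMono q)
    (hpL : ∀ i, p i < L) (hqL : ∀ i, q i < L') :
    (N.submatrix p q).det ∈ S := by
  have hadd : ∀ a k : ℕ, StrictMono fun i : Fin k => a + (i : ℕ) := fun a k i j h => by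
    simpa using h
  refine det_submatrix_mem_of_interval_rows S hinv N L
    (fun k => {q | StrictMono q ∧ ∀ i, q i < L'})
    (fun k q hq => ⟨hq.1.comp Fin.strictMono_castSucc, fun i => hq.2 _⟩)
    (fun k p q hq hp hpL => hne k p q hp hq.1 hpL hq.2) (fun k a q hq ha => ?_) k p q hp hpL
    ⟨hq, hqL⟩
  -- fill the gaps in the columns, the rows being an interval
  rw [← Matrix.det_transpose, Matrix.transpose_submatrix]
  refine det_submatrix_mem_of_interval_rows S hinv N.transpose L'
    (fun k => {r | ∃ a, a + k ≤ L ∧ r = fun i : Fin k => a + (i : ℕ)}) ?_ ?_ ?_ k q _ hq.1 hq.2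
    ⟨a, ha, rfl⟩
  · rintro k _ ⟨a, ha, rfl⟩
    exact ⟨a, by omega, rfl⟩
  · rintro k q _ ⟨a, ha, rfl⟩ hq hqL
    rw [← Matrix.transpose_submatrix, Matrix.det_transpose]
    exact hne _ _ _ (hadd a k) hq (fun i => by have := i.2; omega) hqL
  · rintro k b _ ⟨a, ha, rfl⟩ hb
    rw [← Matrix.transpose_submatrix, Matrix.det_transpose]
    exact hint k a b ha hb

/-! ### Subtraction-free elements -/

/-- The elements of a field that are quotients of polynomials with nonnegative integer coefficients
in the family `c`, the denominator not vanishing at `c`. -/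
def subtractionFree {σ K : Type*} [Field K] (c : σ → K) : Subsemiring K where
  carrier := {x | ∃ P Q : MvPolynomial σ ℕ,
    MvPolynomial.aeval c Q ≠ 0 ∧ x * MvPolynomial.aeval c Q = MvPolynomial.aeval c P}
  one_mem' := ⟨1, 1, by simp, by simp⟩
  zero_mem' := ⟨0, 1, by simp, by simp⟩
  mul_mem' := by
    rintro x y ⟨P, Q, hQ, h⟩ ⟨P', Q', hQ', h'⟩
    refine ⟨P * P', Q * Q', by simp [hQ, hQ'], ?_⟩
    rw [map_mul, map_mul, ← h, ← h']
    ring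
  add_mem' := by
    rintro x y ⟨P, Q, hQ, h⟩ ⟨P', Q', hQ', h'⟩
    refine ⟨P * Q' + P' * Q, Q * Q', by simp [hQ, hQ'], ?_⟩
    rw [map_add, map_mul, map_mul, map_mul, ← h, ← h']
    ring

theorem inv_mem_subtractionFree {σ K : Type*} [Field K] {c : σ → K} :
    ∀ x ∈ subtractionFree c, x⁻¹ ∈ subtractionFree c := by
  rintro x ⟨P, Q, hQ, h⟩
  rcases eq_or_ne x 0 with rfl | hx
  · rw [inv_zero]
    exact zero_mem _
  · exact ⟨Q, P, h ▸ mul_ne_zero hx hQ, by rw [← h, inv_mul_cancel_left₀ hx]⟩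

theorem mem_subtractionFree_self {σ K : Type*} [Field K] (c : σ → K) (i : σ) :
    c i ∈ subtractionFree c :=
  ⟨MvPolynomial.X i, 1, by simp, by simp⟩

/-! ### Contiguous minors and the octahedron recurrence -/

section ContiguousMinors

variable {n : ℕ} {R : Type*} [CommRing R]

theorem contiguousMinor_congr (M : Matrix (ZMod n) (ZMod n) R) {a a' b b' : ℤ} (y : ℕ)
    (ha : (a : ZMod n) = a') (hb : (b : ZMod n) = b') :
    contiguousMinor M a b y = contiguousMinor M a' b' y := by
  simp [contiguousMinor, ha, hb]

theorem contiguousMinor_zero (M : Matrix (ZMod n) (ZMod n) R) (a b : ℤ) :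
    contiguousMinor M a b 0 = 1 :=
  Matrix.det_isEmpty

theorem map_contiguousMinor {R' : Type*} [CommRing R'] (f : R →+* R')
    (M : Matrix (ZMod n) (ZMod n) R) (a b : ℤ) (y : ℕ) :
    f (contiguousMinor M a b y) = contiguousMinor (M.map f) a b y := by
  rw [contiguousMinor, RingHom.map_det]
  rfl

/-- The octahedron recurrence: since the columns are listed in decreasing order, both sides of the
condensation identity are subtraction-free. -/
theorem contiguousMinor_condensation (M : Matrix (ZMod n) (ZMod n) R) (a b : ℤ) (y : ℕ) :
    contiguousMinor M a b (y + 1) * contiguousMinor M (a + 1) (b + 1) (y + 1)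
        + contiguousMinor M a b (y + 2) * contiguousMinor M (a + 1) (b + 1) y =
      contiguousMinor M (a + 1) b (y + 1) * contiguousMinor M a (b + 1) (y + 1) := by
  convert det_condensation (Matrix.of fun i j : Fin (y + 2) =>
    M ((a + (i : ℤ) : ℤ) : ZMod n) ((b + ((y + 2 : ℕ) : ℤ) - 1 - (j : ℤ) : ℤ) : ZMod n)) using 3 <;>
  first
  | rfl
  | (unfold contiguousMinor
     congr 1
     ext i j
     simp only [Matrix.of_apply, Matrix.submatrix_apply, Fin.val_succ, Fin.val_castSucc]
     congr 2 <;> push_cast <;> ring)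

/-- The central minors are the contiguous minors whose starting row and column have distance
`⌊(n-1)/2⌋` (`e = 0`) or `⌊(n-1)/2⌋ + 1` (`e = 1`).  If `n` is even, then the second distance is
`n / 2`, which also allows minors of size `n / 2`. -/
theorem exists_smallCentralMinors_eq [NeZero n] (M : Matrix (ZMod n) (ZMod n) R) (a e : ℤ) (y : ℕ)
    (hy : 1 ≤ y) (he : e = 0 ∧ 2 * y < n ∨ e = 1 ∧ 2 * y ≤ n) :
    ∃ p : SmallIndex n,
      smallCentralMinors M p = contiguousMinor M a (a + (((n - 1) / 2 : ℕ) : ℤ) + e) y := by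
  have hn : 0 < n := NeZero.pos n
  -- `x` is `2 * a + e + y` modulo `2 * n`; rows and columns are shifted by multiples of `n`
  obtain ⟨x, z, hx, hx1, hxn⟩ : ∃ x : ℕ, ∃ z : ℤ,
      (x : ℤ) = 2 * a + e + y - 2 * (n * z) ∧ 1 ≤ x ∧ x ≤ 2 * n := by
    have h0 := Int.emod_nonneg (2 * a + e + y - 1) (b := 2 * n) (by omega)
    have h1 := Int.emod_lt_of_pos (2 * a + e + y - 1) (b := 2 * n) (by omega)
    have h2 := Int.emod_add_mul_ediv (2 * a + e + y - 1) (2 * n)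
    refine ⟨((2 * a + e + y - 1) % (2 * n) + 1).toNat, (2 * a + e + y - 1) / (2 * n), ?_, ?_, ?_⟩
    · rw [Int.toNat_of_nonneg (by omega)]
      linarith
    · omega
    · omega
  refine ⟨⟨(x, y), ⟨hx1, hxn⟩, hy, ?_⟩, ?_⟩
  · rcases he with he | ⟨he, hy'⟩
    · exact Or.inl he.2
    · rcases hy'.lt_or_eq with h | h
      · exact Or.inl h
      · refine Or.inr ⟨h, ?_⟩
        rw [Nat.odd_iff]
        dsimp only
        generalize (n : ℤ) * z = w at hx
        omega
  · have hcast : ((n * z : ℤ) : ZMod n) = 0 := by simp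
    generalize (n : ℤ) * z = w at hx hcast
    have h1 : ((x : ℤ) - y) / 2 = a - w := by omega
    have h2 : ((x : ℤ) - y + n - ((n : ℤ) - 1) % 2) / 2 = a + (((n - 1) / 2 : ℕ) : ℤ) + e - w := by
      omega
    change contiguousMinor M _ _ _ = _
    dsimp only
    rw [h1, h2]
    apply contiguousMinor_congr <;> rw [Int.cast_sub, hcast, sub_zero]

end ContiguousMinors

/-- The octahedron recurrence, started at the small central minors and run outwards in both
directions, reaches every noninterlaced contiguous minor. -/
theorem contiguousMinor_mem {n : ℕ} [NeZero n] {K : Type*} [Field K] (S : Subsemiring K)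
    (hinv : ∀ x ∈ S, x⁻¹ ∈ S) (M : Matrix (ZMod n) (ZMod n) K)
    (hne : ∀ a b y, y ≤ n → contiguousMinor M a b y ≠ 0)
    (hS : ∀ p, smallCentralMinors M p ∈ S) (a d : ℤ) (y : ℕ) (hy : y ≤ d) (hyn : y + d ≤ n) :
    contiguousMinor M a (a + d) y ∈ S := by
  have hn : 0 < n := NeZero.pos n
  set h : ℕ := (n - 1) / 2 with hh
  -- all noninterlaced contiguous minors of distance `d` belong to `S`
  let P : ℤ → Prop := fun d => ∀ (a : ℤ) (y : ℕ), (y : ℤ) ≤ d → y + d ≤ n →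
    contiguousMinor M a (a + d) y ∈ S
  have hpos : ∀ d, (∀ (a : ℤ) (y : ℕ), ((y + 1 : ℕ) : ℤ) ≤ d → (y + 1 : ℕ) + d ≤ n →
      contiguousMinor M a (a + d) (y + 1) ∈ S) → P d := by
    rintro d H a (_ | y) hy hyn
    · rw [contiguousMinor_zero]
      exact one_mem S
    · exact H a y hy hyn
  have base0 : P h := hpos _ fun a y hy hyn => by
    obtain ⟨p, hp⟩ := exists_smallCentralMinors_eq M a 0 (y + 1) (by omega) (Or.inl ⟨rfl, by omega⟩)
    rw [add_zero] at hp
    exact hp ▸ hS p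
  have base1 : P (h + 1) := hpos _ fun a y hy hyn => by
    obtain ⟨p, hp⟩ := exists_smallCentralMinors_eq M a 1 (y + 1) (by omega) (Or.inr ⟨rfl, by omega⟩)
    rw [add_assoc] at hp
    exact hp ▸ hS p
  have hdiv : ∀ x z : K, x ≠ 0 → x ∈ S → x * z ∈ S → z ∈ S := fun x z hx hxS hxz => by
    rw [← inv_mul_cancel_left₀ hx z]
    exact S.mul_mem (hinv x hxS) hxz
  have hrhs : ∀ (d a : ℤ) (y : ℕ), P d → (y : ℤ) + 2 ≤ d → (y : ℤ) + 2 + d ≤ n →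
      contiguousMinor M a (a + d) (y + 1) * contiguousMinor M (a + 1) (a + d + 1) (y + 1)
        + contiguousMinor M a (a + d) (y + 2) * contiguousMinor M (a + 1) (a + d + 1) y ∈ S := by
    intro d a y hd h1 h2
    rw [add_right_comm a d 1]
    exact S.add_mem
      (S.mul_mem (hd _ _ (by omega) (by omega)) (hd _ _ (by omega) (by omega)))
      (S.mul_mem (hd _ _ (by omega) (by omega)) (hd _ _ (by omega) (by omega)))
  -- on either side of the middle, the minors of size `y + 2` that the recurrence uses are still
  -- noninterlaced
  have hup : ∀ d : ℤ, h + 1 ≤ d → P (d - 1) → P d → P (d + 1) := by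
    refine fun d hd h1 h2 => hpos _ fun a y hy hyn => ?_
    have hc := contiguousMinor_condensation M a (a + d) y
    rw [← add_assoc]
    refine hdiv _ _ (hne (a + 1) (a + d) (y + 1) (by omega)) ?_ (hc ▸ hrhs d a y h2 ?_ ?_)
    · rw [show a + d = a + 1 + (d - 1) by ring]
      exact h1 _ _ (by omega) (by omega)
    · omega
    · omega
  have hdown : ∀ d : ℤ, d ≤ h → P (d + 1) → P d → P (d - 1) := by
    refine fun d hd h1 h2 => hpos _ fun a y hy hyn => ?_
    have hc := contiguousMinor_condensation M (a - 1) (a - 1 + d) y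
    rw [mul_comm (contiguousMinor M (a - 1 + 1) _ _), sub_add_cancel] at hc
    rw [show a + (d - 1) = a - 1 + d by ring]
    refine hdiv _ _ (hne (a - 1) (a - 1 + d + 1) (y + 1) (by omega)) ?_
      (hc ▸ ?_)
    · rw [add_assoc (a - 1)]
      exact h1 _ _ (by omega) (by omega)
    · simpa using hrhs d (a - 1) y h2 (by omega) (by omega)
  have up : ∀ e : ℕ, P (h + e) ∧ P (h + e + 1) := by
    intro e
    induction e with
    | zero => simpa using ⟨base0, base1⟩
    | succ e ih =>
      push_cast
      rw [← add_assoc]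
      exact ⟨ih.2, hup _ (by omega) (by simpa using ih.1) ih.2⟩
  have down : ∀ e : ℕ, P (h - e) ∧ P (h - e + 1) := by
    intro e
    induction e with
    | zero => simpa using ⟨base0, base1⟩
    | succ e ih =>
      have he : (h : ℤ) - (e + 1 : ℕ) = h - e - 1 := by push_cast; ring
      rw [he, sub_add_cancel]
      exact ⟨hdown _ (by omega) ih.2 ih.1, ih.1⟩
  suffices P d from this a y hy hyn
  rcases le_total (h : ℤ) d with hd | hd
  · obtain ⟨e, rfl⟩ := Int.le.dest hd
    exact (up e).1
  · obtain ⟨e, he⟩ := Int.le.dest hd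
    rw [show d = h - e by omega]
    exact (down e).1

/-! ### The generic matrix and its circular blocks -/

/-- The minors of the generic matrix without repeated rows or columns do not vanish. -/
theorem det_mvPolynomialX_submatrix_ne_zero {n k : ℕ} {r c : Fin k → ZMod n}
    (hr : Function.Injective r) (hc : Function.Injective c) :
    ((Matrix.mvPolynomialX (ZMod n) (ZMod n) ℤ).submatrix r c).det ≠ 0 := by
  have h : (Matrix.mvPolynomialX (ZMod n) (ZMod n) ℤ).submatrix r c =
      (MvPolynomial.rename (R := ℤ) (Prod.map r c)).mapMatrix
        (Matrix.mvPolynomialX (Fin k) (Fin k) ℤ) := by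
    ext i j : 2
    simp [Matrix.mvPolynomialX]
  rw [h, ← AlgHom.map_det]
  exact (map_ne_zero_iff _ (MvPolynomial.rename_injective _ (hr.prodMap hc))).2
    (Matrix.det_mvPolynomialX_ne_zero _ _)

theorem ZMod.add_natCast_injective {n k : ℕ} (s : ZMod n) {p : Fin k → ℕ}
    (hp : Function.Injective p) (hpn : ∀ i, p i < n) :
    Function.Injective fun i => s + (p i : ZMod n) := by
  intro i j h
  have h1 := (ZMod.natCast_eq_natCast_iff' _ _ _).1 (add_left_cancel h)
  rw [Nat.mod_eq_of_lt (hpn i), Nat.mod_eq_of_lt (hpn j)] at h1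
  exact hp h1

theorem mem_cyclicInterval {n : ℕ} {s x : ZMod n} {l : ℕ} :
    x ∈ cyclicInterval s l ↔ ∃ i < l, s + (i : ZMod n) = x := by
  simp [cyclicInterval]

theorem lt_of_mem_cyclicOffsets {n : ℕ} [NeZero n] {s : ZMod n} {l : ℕ} (hl : l ≤ n)
    {A : Finset (ZMod n)} (hA : A ⊆ cyclicInterval s l) {i : ℕ} (hi : i ∈ cyclicOffsets s A) :
    i < l := by
  obtain ⟨x, hx, rfl⟩ := Finset.mem_image.1 hi
  obtain ⟨j, hj, rfl⟩ := mem_cyclicInterval.1 (hA hx)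
  rwa [add_sub_cancel_left, ZMod.val_natCast_of_lt (hj.trans_le hl)]

/-- Disjoint nonempty circular intervals: the second starts after the end of the first, and ends
before the first starts again. -/
theorem le_val_sub_of_disjoint_cyclicInterval {n : ℕ} [NeZero n] {s t : ZMod n} {l m : ℕ}
    (hl : 0 < l) (hm : 0 < m) (h : Disjoint (cyclicInterval s l) (cyclicInterval t m)) :
    l ≤ (t - s).val ∧ (t - s).val + m ≤ n := by
  rw [Finset.disjoint_left] at h
  have hlt := ZMod.val_lt (t - s)
  constructor
  · by_contra! hd
    refine h (a := t) (mem_cyclicInterval.2 ⟨_, hd, ?_⟩) (mem_cyclicInterval.2 ⟨0, hm, by simp⟩)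
    rw [ZMod.natCast_zmod_val]
    ring
  · by_contra! hd
    refine h (a := s) (mem_cyclicInterval.2 ⟨0, hl, by simp⟩)
      (mem_cyclicInterval.2 ⟨n - (t - s).val, by omega, ?_⟩)
    rw [Nat.cast_sub hlt.le, ZMod.natCast_zmod_val]
    simp

theorem map_cyclicMinor {n : ℕ} [NeZero n] {R R' : Type*} [CommRing R] [CommRing R'] (f : R →+* R')
    (M : Matrix (ZMod n) (ZMod n) R) (s t : ZMod n) (A B : Finset (ZMod n))
    (h : A.card = B.card) :
    f (cyclicMinor M s t A B h) = cyclicMinor (M.map f) s t A B h := by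
  rw [cyclicMinor, RingHom.map_det]
  rfl

theorem map_smallCentralMinors {n : ℕ} {R R' : Type*} [CommRing R] [CommRing R']
    (f : R →+* R') (M : Matrix (ZMod n) (ZMod n) R) (p : SmallIndex n) :
    f (smallCentralMinors M p) = smallCentralMinors (M.map f) p :=
  map_contiguousMinor f M _ _ _

/-- Evaluation of polynomials with natural coefficients at the small central minors commutes with
ring homomorphisms.  The `ℕ`-algebra structures are arguments, since those inferred for polynomial
rings are only propositionally equal to those of general rings. -/
theorem map_aeval_smallCentralMinors {n : ℕ} {R R' : Type*} [CommRing R] [CommRing R']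
    [Algebra ℕ R] [Algebra ℕ R'] (f : R →+* R') (M : Matrix (ZMod n) (ZMod n) R)
    (P : MvPolynomial (SmallIndex n) ℕ) :
    f (MvPolynomial.aeval (smallCentralMinors M) P) =
      MvPolynomial.aeval (smallCentralMinors (M.map f)) P := by
  rw [← funext (map_smallCentralMinors f M)]
  let g : R →ₐ[ℕ] R' := { f with commutes' := fun k => by simp }
  exact MvPolynomial.comp_aeval_apply (smallCentralMinors M) g P

/-- The noninterlaced minors of a matrix with nonvanishing minors lie in every semiring closed under
inverses that contains the small central minors. -/
theorem cyclicMinor_mem {n : ℕ} [NeZero n] {K : Type*} [Field K] (S : Subsemiring K)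
    (hinv : ∀ x ∈ S, x⁻¹ ∈ S) (M : Matrix (ZMod n) (ZMod n) K)
    (hne : ∀ k (r c : Fin k → ZMod n), Function.Injective r → Function.Injective c →
      (M.submatrix r c).det ≠ 0)
    (hS : ∀ p, smallCentralMinors M p ∈ S) {s t : ZMod n} {l m : ℕ} (hl : l ≤ (t - s).val)
    (hm : (t - s).val + m ≤ n) {A B : Finset (ZMod n)} (hA : A ⊆ cyclicInterval s l)
    (hB : B ⊆ cyclicInterval t m) (hAB : A.card = B.card) :
    cyclicMinor M s t A B hAB ∈ S := by
  have hneC : ∀ a b y, y ≤ n → contiguousMinor M a b y ≠ 0 := by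
    intro a b y hy
    have hinj : Function.Injective fun i : Fin y => (i : ℕ) := Fin.val_injective
    have hlt : ∀ i : Fin y, (i : ℕ) < n := fun i => i.2.trans_le hy
    have h := hne y (fun i => (a : ZMod n) + ((i : ℕ) : ZMod n))
      (fun j => ((b : ZMod n) + y - 1) - ((j : ℕ) : ZMod n))
      (ZMod.add_natCast_injective _ hinj hlt) fun i j hij =>
        ZMod.add_natCast_injective 0 hinj hlt (by simpa using hij)
    have heq : contiguousMinor M a b y =
        (M.submatrix (fun i : Fin y => (a : ZMod n) + ((i : ℕ) : ZMod n))
          fun j : Fin y => ((b : ZMod n) + y - 1) - ((j : ℕ) : ZMod n)).det := by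
      unfold contiguousMinor
      congr 1
      ext i j
      simp only [Matrix.of_apply, Matrix.submatrix_apply]
      push_cast
      rfl
    exact heq ▸ h
  -- the block of rows `s, …, s+l-1` and of columns `t+m-1, …, t`
  let N : Matrix ℕ ℕ K := Matrix.of fun i j => M (s + (i : ZMod n)) (t + ((m - 1 - j : ℕ) : ZMod n))
  set p := (cyclicOffsets s A).orderEmbOfFin (card_cyclicOffsets s A) with hp
  set q := (cyclicOffsets t B).orderEmbOfFin (card_cyclicOffsets t B) with hq
  have hpl : ∀ i, p i < l := fun i =>
    lt_of_mem_cyclicOffsets (by omega) hA (Finset.orderEmbOfFin_mem _ _ i)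
  have hqm : ∀ i, q i < m := fun i =>
    lt_of_mem_cyclicOffsets (by omega) hB (Finset.orderEmbOfFin_mem _ _ i)
  have heq : cyclicMinor M s t A B hAB =
      (N.submatrix p fun j => m - 1 - q (Fin.cast hAB j.rev)).det := by
    unfold cyclicMinor cyclicEnum
    congr 1
    ext i j
    have h := hqm (Fin.cast hAB j.rev)
    simp only [N, Matrix.of_apply, Matrix.submatrix_apply]
    rw [Nat.sub_sub_self (by omega)]
  rw [heq]
  refine det_submatrix_mem_of_interval_minors S hinv N l m ?_ ?_ _ _ _ p.strictMono ?_ hpl ?_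
  · intro k p q hp hq hpl hqm
    refine hne k (fun i => s + (p i : ZMod n)) (fun j => t + ((m - 1 - q j : ℕ) : ZMod n))
      (ZMod.add_natCast_injective s hp.injective fun i => (hpl i).trans_le (by omega))
      (ZMod.add_natCast_injective t (fun i j hij => hq.injective ?_) fun i => by
        have := hqm i; omega)
    have h1 := hqm i
    have h2 := hqm j
    omega
  · intro k a b ha hb
    have hmem := contiguousMinor_mem S hinv M hneC hS (s.val + a)
      ((t - s).val + m - k - b - a) k (by omega) (by omega)
    convert hmem using 1
    unfold contiguousMinor
    congr 1
    ext i j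
    obtain ⟨w, hw⟩ : ∃ w, m = w + 1 + (b + j) := ⟨m - 1 - (b + j), by have := j.2; omega⟩
    have hw' : m - 1 - (b + j) = w := by omega
    simp only [N, Matrix.of_apply, Matrix.submatrix_apply, hw']
    have hmw : (m : ZMod n) = w + 1 + (b + (j : ℕ)) := by rw [hw]; push_cast; rfl
    congr 1
    · push_cast
      rw [ZMod.natCast_zmod_val]
      ring
    · push_cast
      rw [ZMod.natCast_zmod_val, ZMod.natCast_zmod_val, hmw]
      ring
  · intro i j hij
    have h1 : q (Fin.cast hAB j.rev) < q (Fin.cast hAB i.rev) :=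
      q.strictMono (by simpa [Fin.lt_def] using Fin.rev_lt_rev.2 hij)
    have h2 := hqm (Fin.cast hAB i.rev)
    dsimp only
    omega
  · intro j
    have := hqm (Fin.cast hAB j.rev)
    omega

theorem cyclicEnum_injective {n : ℕ} [NeZero n] (s : ZMod n) (A : Finset (ZMod n)) :
    Function.Injective (cyclicEnum s A) := by
  refine ZMod.add_natCast_injective s (RelEmbedding.injective _) fun i => ?_
  obtain ⟨x, -, hx⟩ := Finset.mem_image.1 ((cyclicOffsets s A).orderEmbOfFin_mem
    (card_cyclicOffsets s A) i)
  rw [← hx]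
  exact ZMod.val_lt _

/-- A subtraction-free expression of a minor of the generic matrix over a field specializes to
every commutative ring. -/
theorem exists_mul_aeval_eq_of_mem_subtractionFree {n : ℕ} [NeZero n] {K : Type*} [Field K]
    (φ : MvPolynomial (ZMod n × ZMod n) ℤ →+* K) (hφ : Function.Injective φ) (s t : ZMod n)
    (A B : Finset (ZMod n)) (hAB : A.card = B.card)
    (h : cyclicMinor ((Matrix.mvPolynomialX (ZMod n) (ZMod n) ℤ).map φ) s t A B hAB ∈
      subtractionFree (smallCentralMinors ((Matrix.mvPolynomialX (ZMod n) (ZMod n) ℤ).map φ))) :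
    ∃ P Q : MvPolynomial (SmallIndex n) ℕ, P ≠ 0 ∧ Q ≠ 0 ∧
      MvPolynomial.aeval (smallCentralMinors (Matrix.mvPolynomialX (ZMod n) (ZMod n) ℤ)) Q ≠ 0 ∧
      ∀ (R : Type*) [CommRing R] (M : Matrix (ZMod n) (ZMod n) R),
        cyclicMinor M s t A B hAB * MvPolynomial.aeval (smallCentralMinors M) Q =
          MvPolynomial.aeval (smallCentralMinors M) P := by
  obtain ⟨P, Q, hQ, h⟩ := h
  rw [← map_cyclicMinor, ← map_aeval_smallCentralMinors, ← map_aeval_smallCentralMinors,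
    ← map_mul] at h
  rw [← map_aeval_smallCentralMinors, map_ne_zero_iff φ hφ] at hQ
  have hP : MvPolynomial.aeval
      (smallCentralMinors (Matrix.mvPolynomialX (ZMod n) (ZMod n) ℤ)) P ≠ 0 := by
    rw [← hφ h]
    exact mul_ne_zero (det_mvPolynomialX_submatrix_ne_zero (cyclicEnum_injective s A)
      ((cyclicEnum_injective t B).comp ((Fin.cast_injective hAB).comp Fin.rev_injective))) hQ
  refine ⟨P, Q, fun h0 => hP (by rw [h0, map_zero]), fun h0 => hQ (by rw [h0, map_zero]), hQ,
    fun R _ M => ?_⟩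
  let ψ : MvPolynomial (ZMod n × ZMod n) ℤ →+* R :=
    (MvPolynomial.aeval fun p : ZMod n × ZMod n => M p.1 p.2).toRingHom
  have hψ : (Matrix.mvPolynomialX (ZMod n) (ZMod n) ℤ).map ψ = M := by
    ext i j
    simp [ψ, Matrix.mvPolynomialX]
  have hR := congrArg ψ (hφ h)
  rwa [map_mul, map_cyclicMinor, map_aeval_smallCentralMinors, map_aeval_smallCentralMinors,
    hψ] at hR

theorem mainTheorem2 (n : ℕ) [NeZero n] (s t : ZMod n) (l m : ℕ)
    (hdisj : Disjoint (cyclicInterval s l) (cyclicInterval t m))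
    (A B : Finset (ZMod n)) (hA : A ⊆ cyclicInterval s l) (hB : B ⊆ cyclicInterval t m)
    (hAB : A.card = B.card) :
    ∃ P Q : MvPolynomial (SmallIndex n) ℕ, P ≠ 0 ∧ Q ≠ 0 ∧
      MvPolynomial.aeval (smallCentralMinors (Matrix.mvPolynomialX (ZMod n) (ZMod n) ℤ)) Q ≠ 0 ∧
      ∀ (R : Type*) [CommRing R] (M : Matrix (ZMod n) (ZMod n) R),
        cyclicMinor M s t A B hAB * MvPolynomial.aeval (smallCentralMinors M) Q =
          MvPolynomial.aeval (smallCentralMinors M) P := by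
  rcases A.eq_empty_or_nonempty with rfl | hAne
  · refine ⟨1, 1, one_ne_zero, one_ne_zero, by simp, fun R _ M => ?_⟩
    have h : cyclicMinor M s t ∅ B hAB = 1 :=
      haveI : IsEmpty (Fin (∅ : Finset (ZMod n)).card) := Fin.isEmpty
      Matrix.det_isEmpty
    simp [h]
  have hBne : B.Nonempty := by rw [← Finset.card_pos, ← hAB]; exact hAne.card_pos
  have hl : 0 < l := by
    obtain ⟨x, hx⟩ := hAne
    obtain ⟨i, hi, -⟩ := mem_cyclicInterval.1 (hA hx)
    omega
  have hm : 0 < m := by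
    obtain ⟨x, hx⟩ := hBne
    obtain ⟨i, hi, -⟩ := mem_cyclicInterval.1 (hB hx)
    omega
  obtain ⟨hl', hm'⟩ := le_val_sub_of_disjoint_cyclicInterval hl hm hdisj
  have hφ : Function.Injective (algebraMap (MvPolynomial (ZMod n × ZMod n) ℤ)
    (FractionRing (MvPolynomial (ZMod n × ZMod n) ℤ))) := IsFractionRing.injective _ _
  refine exists_mul_aeval_eq_of_mem_subtractionFree _ hφ s t A B hAB
    (cyclicMinor_mem _ inv_mem_subtractionFree _ (fun k r c hr hc => ?_)
      (mem_subtractionFree_self _) hl' hm' hA hB hAB)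
  have h := (map_ne_zero_iff _ hφ).2 (det_mvPolynomialX_submatrix_ne_zero hr hc)
  rwa [RingHom.map_det] at h
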